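/- Conventions. For a finitely generated group $G$, let $S(G)$ be the sphere of classes $[\varphi]$ of non-zero homomorphisms $\varphi:G\to\mathbb{R}$, where $[\varphi]=[\psi]$ if and only if $\varphi=\lambda\psi$ for some $\lambda>0$; put $-[\varphi]=[-\varphi]$. The Bieri–Neumann–Strebel invariant $\Sigma(G)\subset S(G)$ is the set of classes $[\varphi]$ such that, for some (equivalently, every) finite generating set of $G$, the full subgraph of the Cayley graph of $G$ (with edges joining $g$ to $gs$, for $s$ a generator) on the vertices $g$ with $\varphi(g)\ge 0$ is connected. Let $\varsigma$ be the class of finitely generated groups $H$ with $\Sigma(H)=S(H)$. For a subgroup $H\le G$ let $S(G,H)=\{[\varphi]\in S(G)\mid \varphi(H)=0\}$. A rationally defined subsphere of $S(G)$ is the set of classes of the non-zero elements of a linear subspace of $\mathrm{Hom}(G,\mathbb{R})$ spanned by homomorphisms with values in $\mathbb{Q}$; the subspace may be $0$ (giving the empty subsphere) or all of $\mathrm{Hom}(G,\mathbb{R})$. A graph of groups is reduced if, for every edge $e$ with distinct endpoints, the inclusions of the edge group $G_e$ into the two vertex groups at its ends are proper. It is an ascending HNN-extension if it has exactly one vertex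 $v$ and exactly one edge $e$, and at least one of the two inclusions $G_e\hookrightarrow G_v$ is onto. Corollary 2.9. Let $G$ be the fundamental group of a finite connected reduced graph of groups $\Gamma$, with every vertex group in $\varsigma$. Assume that $\Gamma$ is not an ascending HNN-extension. Then, for every non-zero homomorphism $\varphi:G\to\mathbb{R}$, one has $[\varphi]\in\Sigma(G)$ if and only if $\varphi$ is non-trivial on every edge group. In particular, $$\Sigma(G)=-\Sigma(G)=\bigcap_{e}S(G,G_e)^c,$$ where $e$ ranges over the edges of $\Gamma$ and $^c$ denotes the complement in $S(G)$ (the empty intersection being $S(G)$), and $\Sigma(G)$ is the complement in $S(G)$ of the union of finitely many rationally defined subspheres. -/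

import Mathlib

open scoped Pointwise

noncomputable section

/-! ### The character sphere and the Bieri-Neumann-Strebel invariant -/

namespace BNS

/-- The real vector space `Hom(G, ℝ)` of homomorphisms from `G` to the additive group `ℝ`. -/
abbrev Character (G : Type*) [Group G] : Type _ := Additive G →+ ℝ

/-- The value `φ(g)`. -/
abbrev Character.val {G : Type*} [Group G] (φ : Character G) (g : G) : ℝ := φ (Additive.ofMul g)

/-- The character sphere `S(G)`: classes `[φ]` of non-zero homomorphisms `φ : G → ℝ`, where
`[φ] = [ψ]` if and only if `φ = r • ψ` for some `r > 0`. -/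
abbrev Sphere (G : Type*) [Group G] : Type _ := Module.Ray ℝ (Character G)

/-- The class `[φ]` in `S(G)` of a non-zero homomorphism `φ`. -/
abbrev toSphere {G : Type*} [Group G] (φ : Character G) (hφ : φ ≠ 0) : Sphere G :=
  rayOfNeZero ℝ φ hφ

/-- `Cay(G, S)^{[0, ∞)}`: the subgraph of the Cayley graph of `G` with respect to `S` (with edges
joining `g` to `g * s` for `s ∈ S`) induced on the vertices `g` such that `φ(g) ≥ 0`. -/
def nonnegCayley {G : Type*} [Group G] (S : Set G) (φ : Character G) :
    SimpleGraph {g : G | 0 ≤ φ.val g} :=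
  (SimpleGraph.mulCayley S).induce {g : G | 0 ≤ φ.val g}

/-- The BNS invariant `Σ(G) ⊆ S(G)` of a (finitely generated) group: `[φ]` belongs to `Σ(G)` if and
only if `Cay(G, S)^{[0, ∞)}` is connected for some finite generating set `S` of `G`. -/
def sigmaSet (G : Type*) [Group G] : Set (Sphere G) :=
  {ξ | ∃ (φ : Character G) (hφ : φ ≠ 0), toSphere φ hφ = ξ ∧
    ∃ S : Set G, S.Finite ∧ Subgroup.closure S = ⊤ ∧ (nonnegCayley S φ).Connected}

/-- The class `ς` of finitely generated groups `H` such that `Σ(H) = S(H)`. -/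
def InVarsigma (H : Type*) [Group H] : Prop :=
  Group.FG H ∧ sigmaSet H = Set.univ

/-- The subsphere of `S(G)` consisting of the classes of the non-zero elements of a linear subspace
of `Hom(G, ℝ)` (empty if the subspace is `0`). -/
def sphereOf {G : Type*} [Group G] (W : Submodule ℝ (Character G)) : Set (Sphere G) :=
  {ξ | ∃ (φ : Character G) (hφ : φ ≠ 0), toSphere φ hφ = ξ ∧ φ ∈ W}

/-- The subsphere `S(G, H) = {[φ] ∈ S(G) | H ⊆ ker φ}`. -/
def subsphere {G : Type*} [Group G] (H : Subgroup G) : Set (Sphere G) :=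
  {ξ | ∃ (φ : Character G) (hφ : φ ≠ 0), toSphere φ hφ = ξ ∧ ∀ h ∈ H, φ.val h = 0}

/-- A linear subspace of `Hom(G, ℝ)` is rational (defined over `ℚ`) if it is spanned over `ℝ` by the
homomorphisms with values in `ℚ` which it contains. -/
def IsRationalSubspace {G : Type*} [Group G] (W : Submodule ℝ (Character G)) : Prop :=
  Submodule.span ℝ {φ : Character G | φ ∈ W ∧ ∀ g : G, ∃ q : ℚ, φ.val g = q} = W

/-- A rationally defined subsphere of `S(G)` is the subsphere given by a rational linear subspace of
`Hom(G, ℝ)`. -/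
def IsRationallyDefined {G : Type*} [Group G] (T : Set (Sphere G)) : Prop :=
  ∃ W : Submodule ℝ (Character G), IsRationalSubspace W ∧ T = sphereOf W

end BNS

/-! ### Graphs of groups and their fundamental groups -/

/-- A graph of groups with vertex set `V` and set `E` of (geometric) edges. Each edge `e` is given an
orientation, from `src e` to `tgt e`; loops and multiple edges are allowed. Each edge group embeds
in the groups of the two ends of the edge. -/
structure GraphOfGroups (V E : Type*) where
  src : E → V
  tgt : E → V
  vertexGroup : V → Type*
  edgeGroup : E → Type*
  [vertexGroupInst : ∀ x, Group (vertexGroup x)]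
  [edgeGroupInst : ∀ e, Group (edgeGroup e)]
  toSrc : ∀ e, edgeGroup e →* vertexGroup (src e)
  toTgt : ∀ e, edgeGroup e →* vertexGroup (tgt e)
  toSrc_injective : ∀ e, Function.Injective (toSrc e)
  toTgt_injective : ∀ e, Function.Injective (toTgt e)

namespace GraphOfGroups

attribute [instance] GraphOfGroups.vertexGroupInst GraphOfGroups.edgeGroupInst

variable {V E : Type*} (Γ : GraphOfGroups V E)

/-- The subgraph with all the vertices and with edge set `T` is connected (and non-empty). -/
def ConnectedBy (T : Set E) : Prop :=
  Nonempty V ∧ ∀ x y : V, Relation.EqvGen (fun a b => ∃ e ∈ T, Γ.src e = a ∧ Γ.tgt e = b) x y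

/-- `T` is the edge set of a maximal (i.e. spanning) tree of the underlying graph: a set of edges
which connects all the vertices, and which is minimal with this property. -/
def IsMaximalTree (T : Set E) : Prop :=
  Minimal Γ.ConnectedBy T

/-- The free product of all the vertex groups and of the free group on the edges. -/
abbrev PathGroup : Type _ := Monoid.Coprod (Monoid.CoprodI Γ.vertexGroup) (FreeGroup E)

/-- The inclusion of a vertex group in the free product. -/
def vertexIn (x : V) : Γ.vertexGroup x →* Γ.PathGroup :=
  Monoid.Coprod.inl.comp Monoid.CoprodI.of

/-- The free generator `t_e` of the free product. -/
def stable (e : E) : Γ.PathGroup :=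
  Monoid.Coprod.inr (FreeGroup.of e)

/-- The relators of the fundamental group with respect to `T`:
`t_e⁻¹ a t_e = a'` for each edge `e` and each element of `G_e`, with images `a` and `a'` in the
groups of the source and of the target of `e`, and `t_e = 1` for `e ∈ T`. -/
def relators (T : Set E) : Set Γ.PathGroup :=
  {r | ∃ (e : E) (a : Γ.edgeGroup e), r = (Γ.stable e)⁻¹ * Γ.vertexIn (Γ.src e) (Γ.toSrc e a) *
      Γ.stable e * (Γ.vertexIn (Γ.tgt e) (Γ.toTgt e a))⁻¹} ∪
  {r | ∃ e ∈ T, r = Γ.stable e}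

/-- The fundamental group `π₁(Γ, T)` of a graph of groups with respect to a maximal tree `T`. -/
abbrev FundamentalGroup (T : Set E) : Type _ :=
  Γ.PathGroup ⧸ Subgroup.normalClosure (Γ.relators T)

/-- The natural homomorphism from a vertex group to the fundamental group. -/
def vertexMap (T : Set E) (x : V) : Γ.vertexGroup x →* Γ.FundamentalGroup T :=
  (QuotientGroup.mk' (Subgroup.normalClosure (Γ.relators T))).comp (Γ.vertexIn x)

/-- The natural homomorphism from an edge group to the fundamental group (through the source of the
edge; going through its target gives a conjugate homomorphism). -/
def edgeMap (T : Set E) (e : E) : Γ.edgeGroup e →* Γ.FundamentalGroup T :=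
  (Γ.vertexMap T (Γ.src e)).comp (Γ.toSrc e)

/-- The edge group `G_e` as a subgroup of the fundamental group. -/
def edgeSubgroup (T : Set E) (e : E) : Subgroup (Γ.FundamentalGroup T) :=
  (Γ.edgeMap T e).range

/-- `Γ` is reduced: if `e` has distinct end points, its group is mapped to proper subgroups of the
two vertex groups. -/
def IsReduced : Prop :=
  ∀ e, Γ.src e ≠ Γ.tgt e →
    ¬ Function.Surjective (Γ.toSrc e) ∧ ¬ Function.Surjective (Γ.toTgt e)

/-- `Γ` is an ascending HNN-extension (for one of the two orientations of its edge): it has exactly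
one vertex and exactly one edge, and at least one of the two embeddings of the edge group in the
vertex group is onto. -/
def IsAscendingHNN : Prop :=
  Nat.card V = 1 ∧ Nat.card E = 1 ∧
    ∃ e, Function.Surjective (Γ.toSrc e) ∨ Function.Surjective (Γ.toTgt e)

end GraphOfGroups

end

/-!
The Bass-Serre tree of `Γ` is used only through its shadow on the group `G = π₁(Γ, T)`: a function
`side : G → ℤ/2` which tells on which side of a given edge `e` a group element lies.

*Characters which vanish on an edge group `C` are not in `Σ(G)`.* The function `side` changes, under
left multiplication by a generator, only on entering or leaving `C`. There `φ` is bounded. The edges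
of the Cayley graph are right multiplications, so `side` is evaluated at inverses, which reverses
heights: if the part `φ ≥ 0` of the Cayley graph were connected, a translate of it would miss all
the changes and `side` would be constant where `φ` is very negative
(`BNS.eventually_const_of_connected`). On the other hand, from a point outside `C` with `φ ≤ 0`, the
powers of a generator lead arbitrarily far down without meeting `C` again
(`BNS.side_eq_of_connected`), so it suffices to find such points on both sides of `e`. For `e` in
the tree, these are elements of the two vertex groups outside `C`, which exist because `Γ` is
reduced. For `e` outside the tree, they are generators other than `t_e`, one of them conjugated by
`t_e`; if an embedding of the edge group is onto, another edge supplies them, as `Γ` is not an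
ascending HNN-extension (`IsMaximalTree.exists_generator_notMem_range`).

The function `side` comes from an action of `G` on two copies of `G` which are exchanged along `C`
(`IsMaximalTree.exists_side`). That elements of a vertex group outside the edge group stay outside
it in `G` follows from the faithfulness of the vertex groups in `G`, proved by letting all of them
act freely, with many orbits, on one set (`IsMaximalTree.vertexMap_injective`). Both actions are
given by `IsMaximalTree.exists_hom`, which rests on the triviality of cocycles on a tree.

*Characters which are non-trivial on all edge groups are in `Σ(G)`.* The part `φ ≥ 0` of each coset
of a vertex group is connected because the vertex groups are in `ς`, and adjacent cosets are linked
since `φ` is unbounded above on each edge group (`ConnectedBy.connected_nonnegCayley`).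

Rationality of the subspheres holds because the image of a character is free abelian of finite rank
(`BNS.isRationalSubspace_vanishing`).
-/

noncomputable section

namespace GraphOfGroups

/-! ### Generators and relations of the fundamental group -/

section Presentation

variable {V E : Type*} (Γ : GraphOfGroups V E) (T : Set E)

/-- The image in `π₁(Γ, T)` of the free generator `t_e`. -/
def stableMap (e : E) : Γ.FundamentalGroup T :=
  QuotientGroup.mk' (Subgroup.normalClosure (Γ.relators T)) (Γ.stable e)

theorem stableMap_eq_one {e : E} (he : e ∈ T) : Γ.stableMap T e = 1 :=
  (QuotientGroup.eq_one_iff _).2 (Subgroup.subset_normalClosure (Or.inr ⟨e, he, rfl⟩))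

theorem stableMap_conj (e : E) (a : Γ.edgeGroup e) :
    (Γ.stableMap T e)⁻¹ * Γ.vertexMap T (Γ.src e) (Γ.toSrc e a) * Γ.stableMap T e =
      Γ.vertexMap T (Γ.tgt e) (Γ.toTgt e a) := by
  rw [← mul_inv_eq_one]
  exact (QuotientGroup.eq_one_iff _).2 (Subgroup.subset_normalClosure (Or.inl ⟨e, a, rfl⟩))

/-- The images of the vertex groups and the elements `t_e`. -/
def generators : Set (Γ.FundamentalGroup T) :=
  {g | (∃ v h, g = Γ.vertexMap T v h) ∨ ∃ e, g = Γ.stableMap T e}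

theorem closure_generators : Subgroup.closure (Γ.generators T) = ⊤ := by
  let π : Γ.PathGroup →* Γ.FundamentalGroup T :=
    QuotientGroup.mk' (Subgroup.normalClosure (Γ.relators T))
  let K := (Subgroup.closure (Γ.generators T)).comap π
  have hK : ∀ x : Γ.PathGroup, x ∈ K := by
    intro x
    induction x using Monoid.Coprod.induction_on with
    | inl y =>
      induction y using Monoid.CoprodI.induction_on with
      | one => rw [map_one]; exact K.one_mem
      | of v h => exact Subgroup.subset_closure (Or.inl ⟨v, h, rfl⟩)
      | mul y z hy hz => rw [map_mul]; exact K.mul_mem hy hz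
    | inr y =>
      induction y using FreeGroup.induction_on with
      | C1 => rw [map_one]; exact K.one_mem
      | of e => exact Subgroup.subset_closure (Or.inr ⟨e, rfl⟩)
      | inv_of e h => rw [map_inv]; exact K.inv_mem h
      | mul y z hy hz => rw [map_mul]; exact K.mul_mem hy hz
    | mul y z hy hz => exact K.mul_mem hy hz
  rw [eq_top_iff]
  intro g _
  obtain ⟨x, rfl⟩ := QuotientGroup.mk'_surjective _ g
  exact hK x

/-- The universal property of `π₁(Γ, T)`. -/
theorem exists_lift {H : Type*} [Group H] (ρ : ∀ v, Γ.vertexGroup v →* H) (τ : E → H)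
    (hrel : ∀ e a, (τ e)⁻¹ * ρ (Γ.src e) (Γ.toSrc e a) * τ e = ρ (Γ.tgt e) (Γ.toTgt e a))
    (hτ : ∀ e ∈ T, τ e = 1) :
    ∃ Φ : Γ.FundamentalGroup T →* H,
      (∀ v h, Φ (Γ.vertexMap T v h) = ρ v h) ∧ ∀ e, Φ (Γ.stableMap T e) = τ e := by
  let Ψ : Γ.PathGroup →* H := Monoid.Coprod.lift (Monoid.CoprodI.lift ρ) (FreeGroup.lift τ)
  have hv : ∀ v h, Ψ (Γ.vertexIn v h) = ρ v h := fun v h => by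
    simp [Ψ, vertexIn, Monoid.Coprod.lift_apply_inl]
  have hs : ∀ e, Ψ (Γ.stable e) = τ e := fun e => by
    simp [Ψ, stable, Monoid.Coprod.lift_apply_inr]
  have hker : Subgroup.normalClosure (Γ.relators T) ≤ Ψ.ker := by
    apply Subgroup.normalClosure_le_normal
    rintro r (⟨e, a, rfl⟩ | ⟨e, he, rfl⟩)
    · change Ψ _ = 1
      rw [map_mul, map_mul, map_mul, map_inv, map_inv, hv, hv, hs, hrel, mul_inv_cancel]
    · exact (hs e).trans (hτ e he)
  exact ⟨QuotientGroup.lift _ Ψ hker, hv, hs⟩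

end Presentation

/-! ### Potentials on a maximal tree -/

section Tree

variable {V E : Type*} {Γ : GraphOfGroups V E} {T : Set E}

theorem ConnectedBy.exists_boundary_edge (hT : Γ.ConnectedBy T) {S : Set V} {x y : V}
    (hx : x ∈ S) (hy : y ∉ S) :
    ∃ e ∈ T, (Γ.src e ∈ S ∧ Γ.tgt e ∉ S) ∨ (Γ.src e ∉ S ∧ Γ.tgt e ∈ S) := by
  by_contra! hcon
  have key : ∀ a b : V, Relation.EqvGen (fun a b => ∃ e ∈ T, Γ.src e = a ∧ Γ.tgt e = b) a b →
      (a ∈ S ↔ b ∈ S) := by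
    intro a b hab
    induction hab with
    | rel a b h =>
      obtain ⟨e, he, rfl, rfl⟩ := h
      have := hcon e he
      tauto
    | refl a => rfl
    | symm a b _ ih => exact ih.symm
    | trans a b c _ _ ih1 ih2 => exact ih1.trans ih2
  exact hy ((key x y (hT.2 x y)).1 hx)

/-- A tree is simply connected: every function `τ` from its edges to a group is the coboundary of
a function `u` on its vertices. The set on which `u` is defined is enlarged one edge at a time; the
edges used in this way connect all the vertices, so by minimality they are all the edges of `T`. -/
theorem IsMaximalTree.exists_potential [Finite V] (hT : Γ.IsMaximalTree T) {H : Type*} [Group H]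
    (N : Subgroup H) (τ : E → H) (hτ : ∀ e ∈ T, τ e ∈ N) :
    ∃ u : V → H, (∀ v, u v ∈ N) ∧ ∀ e ∈ T, u (Γ.src e) = τ e * u (Γ.tgt e) := by
  classical
  obtain ⟨x₀⟩ := hT.1.1
  let P : Set V → Prop := fun S => x₀ ∈ S ∧ ∃ (A : Set E) (u : V → H), A ⊆ T ∧ (∀ v, u v ∈ N) ∧
    (∀ e ∈ A, Γ.src e ∈ S ∧ Γ.tgt e ∈ S ∧ u (Γ.src e) = τ e * u (Γ.tgt e)) ∧
    ∀ x ∈ S, Relation.EqvGen (fun a b => ∃ e ∈ A, Γ.src e = a ∧ Γ.tgt e = b) x₀ x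
  have hP₀ : P {x₀} := by
    refine ⟨rfl, ∅, fun _ => 1, Set.empty_subset _, fun _ => N.one_mem, by simp, ?_⟩
    rintro x rfl
    exact Relation.EqvGen.refl _
  obtain ⟨S, hS⟩ := (Set.toFinite {S | P S}).exists_maximal ⟨_, hP₀⟩
  obtain ⟨hx₀, A, u, hAT, huN, hA, hconn⟩ := hS.1
  have mono : ∀ (B : Set E), A ⊆ B → ∀ x y,
      Relation.EqvGen (fun a b => ∃ e ∈ A, Γ.src e = a ∧ Γ.tgt e = b) x y →
      Relation.EqvGen (fun a b => ∃ e ∈ B, Γ.src e = a ∧ Γ.tgt e = b) x y := by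
    intro B hAB x y h
    induction h with
    | rel a b h => exact Relation.EqvGen.rel _ _ (h.imp fun e he => ⟨hAB he.1, he.2⟩)
    | refl a => exact Relation.EqvGen.refl _
    | symm a b _ ih => exact ih.symm
    | trans a b c _ _ ih1 ih2 => exact ih1.trans _ _ _ ih2
  -- One more edge `e`, one more vertex `w`, at which `u` takes the value `k`.
  have extend : ∀ e ∈ T, ∀ (w : V) (k : H), k ∈ N → w ∉ S →
      (Γ.src e ∈ S ∧ Γ.tgt e = w ∧ u (Γ.src e) = τ e * k ∨
        Γ.src e = w ∧ Γ.tgt e ∈ S ∧ k = τ e * u (Γ.tgt e)) → False := by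
    intro e he w k hk hw hcase
    have hne : ∀ x ∈ S, x ≠ w := fun x hx h => hw (h ▸ hx)
    have hu : ∀ x ∈ S, Function.update u w k x = u x := fun x hx =>
      Function.update_of_ne (hne x hx) _ _
    have hP : P (insert w S) := by
      refine ⟨Or.inr hx₀, insert e A, Function.update u w k, Set.insert_subset he hAT, ?_, ?_, ?_⟩
      · intro v
        by_cases h : v = w
        · subst h; simpa using hk
        · simpa [Function.update_of_ne h] using huN v
      · rintro f (rfl | hf)
        · rcases hcase with ⟨h1, rfl, h3⟩ | ⟨rfl, h2, h3⟩
          · exact ⟨Or.inr h1, Or.inl rfl, by rw [hu _ h1, Function.update_self, h3]⟩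
          · exact ⟨Or.inl rfl, Or.inr h2, by rw [hu _ h2, Function.update_self, h3]⟩
        · obtain ⟨h1, h2, h3⟩ := hA f hf
          exact ⟨Or.inr h1, Or.inr h2, by rw [hu _ h1, hu _ h2, h3]⟩
      · rintro x (rfl | hx)
        · rcases hcase with ⟨h1, rfl, -⟩ | ⟨rfl, h2, -⟩
          · exact (mono _ (Set.subset_insert _ _) _ _ (hconn _ h1)).trans _ _ _
              (Relation.EqvGen.rel _ _ ⟨e, Or.inl rfl, rfl, rfl⟩)
          · exact (mono _ (Set.subset_insert _ _) _ _ (hconn _ h2)).trans _ _ _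
              (Relation.EqvGen.symm _ _ (Relation.EqvGen.rel _ _ ⟨e, Or.inl rfl, rfl, rfl⟩))
        · exact mono _ (Set.subset_insert _ _) _ _ (hconn _ hx)
    exact hw (hS.2 hP (Set.subset_insert _ _) (Or.inl rfl))
  have hall : ∀ x, x ∈ S := by
    intro x
    by_contra hx
    obtain ⟨e, he, ⟨h1, h2⟩ | ⟨h1, h2⟩⟩ := hT.1.exists_boundary_edge hx₀ hx
    · exact extend e he _ ((τ e)⁻¹ * u (Γ.src e)) (N.mul_mem (N.inv_mem (hτ e he)) (huN _)) h2
        (Or.inl ⟨h1, rfl, by group⟩)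
    · exact extend e he _ (τ e * u (Γ.tgt e)) (N.mul_mem (hτ e he) (huN _)) h1
        (Or.inr ⟨rfl, h2, rfl⟩)
  have hTA : T ⊆ A := hT.2 ⟨⟨x₀⟩, fun x y =>
    ((hconn x (hall x)).symm _ _).trans _ _ _ (hconn y (hall y))⟩ hAT
  exact ⟨u, huN, fun e he => (hA e (hTA he)).2.2⟩

theorem IsMaximalTree.src_ne_tgt [Finite V] (hT : Γ.IsMaximalTree T) {e : E} (he : e ∈ T) :
    Γ.src e ≠ Γ.tgt e := by
  intro h
  obtain ⟨u, -, hu⟩ := hT.exists_potential (H := Multiplicative (ZMod 2)) ⊤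
    (fun _ => Multiplicative.ofAdd 1) (fun _ _ => trivial)
  have := hu e he
  rw [h] at this
  exact absurd (right_eq_mul.1 this) (by decide)

/-- Actions of the vertex groups together with elements `τ_e` which intertwine them along the edges
define a representation of `π₁(Γ, T)`, without the condition `τ_e = 1` for `e ∈ T`: this condition
is achieved by conjugating the action of each vertex group by a potential for `τ` on the tree. -/
theorem IsMaximalTree.exists_hom [Finite V] (hT : Γ.IsMaximalTree T) {H : Type*} [Group H]
    (N : Subgroup H) (ρ : ∀ v, Γ.vertexGroup v →* H) (τ : E → H)
    (hrel : ∀ e a, (τ e)⁻¹ * ρ (Γ.src e) (Γ.toSrc e a) * τ e = ρ (Γ.tgt e) (Γ.toTgt e a))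
    (hτ : ∀ e ∈ T, τ e ∈ N) :
    ∃ (Φ : Γ.FundamentalGroup T →* H) (u : V → H), (∀ v, u v ∈ N) ∧
      (∀ e ∈ T, u (Γ.src e) = τ e * u (Γ.tgt e)) ∧
      (∀ v h, Φ (Γ.vertexMap T v h) = (u v)⁻¹ * ρ v h * u v) ∧
      ∀ e, Φ (Γ.stableMap T e) = (u (Γ.src e))⁻¹ * τ e * u (Γ.tgt e) := by
  obtain ⟨u, huN, hu⟩ := hT.exists_potential N τ hτ
  obtain ⟨Φ, h1, h2⟩ := Γ.exists_lift T
    (fun v => ((MulAut.conj (u v)⁻¹).toMonoidHom.comp (ρ v) : Γ.vertexGroup v →* H))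
    (fun e => (u (Γ.src e))⁻¹ * τ e * u (Γ.tgt e)) (by
      intro e a
      simp only [MonoidHom.comp_apply, MulEquiv.coe_toMonoidHom, MulAut.conj_apply, ← hrel e a]
      group) (by
      intro e he
      simp only [hu e he]
      group)
  exact ⟨Φ, u, huN, hu, fun v h => by simp [h1], h2⟩

end Tree

/-! ### The vertex groups embed -/

section Embedding

/-- The free `B`-set `B × Ω`, considered as an `A`-set by means of an embedding of `A` in `B`, is
isomorphic to `A × Ω` if the orbit space `Ω` absorbs transversals of `A` in `B`. -/
theorem exists_trivialization {A B Ω : Type*} [Group A] [Group B] (f : A →* B)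
    (hf : Function.Injective f) (hΩ : ∀ S : Set B, S.Nonempty → Nonempty (S × Ω ≃ Ω)) :
    ∃ k : A × Ω ≃ B × Ω, ∀ a a' ω, k (a * a', ω) = (f a * (k (a', ω)).1, (k (a', ω)).2) := by
  obtain ⟨S, hS, h1⟩ := f.range.exists_isComplement_right 1
  obtain ⟨i⟩ := hΩ S ⟨1, h1⟩
  let j : A × S ≃ B :=
    ((MonoidHom.ofInjective hf).toEquiv.prodCongr (Equiv.refl S)).trans (Equiv.ofBijective _ hS)
  have hj : ∀ a s, j (a, s) = f a * s := fun a s => rfl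
  let k : A × Ω ≃ B × Ω :=
    ((Equiv.refl A).prodCongr i.symm).trans
      ((Equiv.prodAssoc A S Ω).symm.trans (j.prodCongr (Equiv.refl Ω)))
  have hk : ∀ a ω, k (a, ω) = (f a * (i.symm ω).1, (i.symm ω).2) := fun a ω => rfl
  exact ⟨k, fun a a' ω => by rw [hk, hk, map_mul, mul_assoc]⟩

theorem nonempty_prod_equiv {α Ω : Type*} [Nonempty α] [Infinite Ω] (f : α → Ω)
    (hf : Function.Injective f) : Nonempty (α × Ω ≃ Ω) := by
  obtain ⟨i⟩ : Nonempty (Ω × Ω ≃ Ω) := by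
    rw [← Cardinal.eq, Cardinal.mk_prod, Cardinal.lift_id]
    exact Cardinal.mul_eq_self (Cardinal.aleph0_le_mk Ω)
  obtain ⟨x⟩ := ‹Nonempty α›
  exact Function.Embedding.antisymm
    ⟨fun p => i (f p.1, p.2), fun p q h => by
      obtain ⟨h1, h2⟩ := Prod.mk.inj (i.injective h)
      exact Prod.ext (hf h1) h2⟩
    ⟨fun ω => (x, ω), fun _ _ h => (Prod.mk.inj h).2⟩

variable {V E : Type*} {Γ : GraphOfGroups V E} {T : Set E}

theorem IsMaximalTree.vertexMap_injective [Finite V] (hT : Γ.IsMaximalTree T) (v : V) :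
    Function.Injective (Γ.vertexMap T v) := by
  let Ω := (Σ v, Γ.vertexGroup v) ⊕ ℕ
  have inj : ∀ v, Function.Injective fun g : Γ.vertexGroup v => (Sum.inl ⟨v, g⟩ : Ω) :=
    fun v => Sum.inl_injective.comp sigma_mk_injective
  have hΩ : ∀ v (S : Set (Γ.vertexGroup v)), S.Nonempty → Nonempty (S × Ω ≃ Ω) := fun v S hS => by
    have := hS.to_subtype
    exact nonempty_prod_equiv _ ((inj v).comp Subtype.val_injective)
  have j : ∀ v, Γ.vertexGroup v × Ω ≃ Ω := fun v =>
    (nonempty_prod_equiv _ (inj v)).some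
  choose ks hks using fun e => exists_trivialization (Γ.toSrc e) (Γ.toSrc_injective e) (hΩ _)
  choose kt hkt using fun e => exists_trivialization (Γ.toTgt e) (Γ.toTgt_injective e) (hΩ _)
  let ρ : ∀ v, Γ.vertexGroup v →* Equiv.Perm Ω := fun v =>
    { toFun := fun g => (j v).symm.trans
        (((Equiv.mulLeft g).prodCongr (Equiv.refl Ω)).trans (j v))
      map_one' := by ext; simp
      map_mul' := fun g g' => by ext; simp [Prod.map] }
  have hρ : ∀ v g g' ω, ρ v g (j v (g', ω)) = j v (g * g', ω) := fun v g g' ω => by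
    simp [ρ]
  let τ : E → Equiv.Perm Ω := fun e =>
    (j (Γ.tgt e)).symm.trans ((kt e).symm.trans ((ks e).trans (j (Γ.src e))))
  have hτ : ∀ e p, τ e (j (Γ.tgt e) (kt e p)) = j (Γ.src e) (ks e p) := fun e p => by
    simp [τ]
  obtain ⟨Φ, u, -, -, hΦ, -⟩ := hT.exists_hom ⊤ ρ τ (by
    intro e a
    rw [mul_assoc, inv_mul_eq_iff_eq_mul]
    ext ω
    obtain ⟨⟨a', ω'⟩, rfl⟩ := ((kt e).trans (j (Γ.tgt e))).surjective ω
    change ρ _ _ (τ e (j _ (kt e (a', ω')))) = τ e (ρ _ _ (j _ (kt e (a', ω'))))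
    rw [hτ, hρ, hρ, ← hks, ← hkt, hτ]) (fun _ _ => trivial)
  rw [injective_iff_map_eq_one]
  intro g hg
  have h1 := hΦ v g
  rw [hg, map_one] at h1
  have h2 : ρ v g = 1 := by
    have : ρ v g = u v * ((u v)⁻¹ * ρ v g * u v) * (u v)⁻¹ := by group
    rw [this, ← h1]; group
  have h3 := hρ v g 1 (Sum.inr 0)
  rw [h2] at h3
  simpa using ((j v).injective h3).symm

end Embedding

end GraphOfGroups

namespace GraphOfGroups

/-! ### The two sides of an edge -/

section Side

open Classical in
/-- The indicator function of a subgroup, with values in `ℤ/2`. -/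
def crossing {G : Type*} [Group G] (C : Subgroup G) (g : G) : ZMod 2 :=
  if g ∈ C then 1 else 0

theorem crossing_of_mem {G : Type*} [Group G] {C : Subgroup G} {g : G} (h : g ∈ C) :
    crossing C g = 1 := if_pos h

theorem crossing_of_notMem {G : Type*} [Group G] {C : Subgroup G} {g : G} (h : g ∉ C) :
    crossing C g = 0 := if_neg h

theorem crossing_mul_left {G : Type*} [Group G] {C : Subgroup G} {a : G} (ha : a ∈ C) (g : G) :
    crossing C (a * g) = crossing C g := by
  by_cases hg : g ∈ C
  · rw [crossing_of_mem hg, crossing_of_mem (C.mul_mem ha hg)]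
  · rw [crossing_of_notMem hg, crossing_of_notMem (fun h => hg ((C.mul_mem_cancel_left ha).1 h))]

/-- The permutation of `G × ℤ/2` which adds `χ` to the second coordinate above `C`. -/
def shift {G : Type*} [Group G] (C : Subgroup G) :
    Multiplicative (ZMod 2) →* Equiv.Perm (G × ZMod 2) where
  toFun χ :=
    { toFun := fun p => (p.1, p.2 + χ.toAdd * crossing C p.1)
      invFun := fun p => (p.1, p.2 - χ.toAdd * crossing C p.1)
      left_inv := fun p => by simp
      right_inv := fun p => by simp }
  map_one' := by ext p <;> simp
  map_mul' χ ψ := by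
    ext p
    · rfl
    · simp only [toAdd_mul, Equiv.Perm.mul_apply, Equiv.coe_fn_mk]
      ring

theorem shift_apply {G : Type*} [Group G] (C : Subgroup G) (χ : Multiplicative (ZMod 2))
    (p : G × ZMod 2) : shift C χ p = (p.1, p.2 + χ.toAdd * crossing C p.1) := rfl

theorem shift_inv_apply {G : Type*} [Group G] (C : Subgroup G) (χ : Multiplicative (ZMod 2))
    (p : G × ZMod 2) : (shift C χ)⁻¹ p = (p.1, p.2 - χ.toAdd * crossing C p.1) := rfl

theorem shift_injective {G : Type*} [Group G] (C : Subgroup G) :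
    Function.Injective (shift C) := by
  intro χ ψ h
  have := congrArg (fun σ : Equiv.Perm (G × ZMod 2) => (σ (1, 0)).2) h
  simpa [shift_apply, crossing_of_mem C.one_mem] using this

/-- Left translation of the first coordinate of `G × ℤ/2`. -/
def translate (G : Type*) [Group G] : G →* Equiv.Perm (G × ZMod 2) where
  toFun g := (Equiv.mulLeft g).prodCongr (Equiv.refl _)
  map_one' := by ext p <;> simp
  map_mul' g h := by ext p <;> simp [mul_assoc]

theorem translate_apply {G : Type*} [Group G] (g : G) (p : G × ZMod 2) :
    translate G g p = (g * p.1, p.2) := rfl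

theorem commute_shift_translate {G : Type*} [Group G] {C : Subgroup G} {a : G} (ha : a ∈ C)
    (χ : Multiplicative (ZMod 2)) : shift C χ * translate G a = translate G a * shift C χ := by
  ext p
  · rfl
  · simp [shift_apply, translate_apply, crossing_mul_left ha]

variable {V E : Type*} {Γ : GraphOfGroups V E} {T : Set E}

/-- The side of an edge `e` on which a group element lies. In terms of the Bass-Serre tree, whose
edge `e` has stabilizer `C`, `side g` says on which side of `e` the translates by `g⁻¹` of a base
vertex are, and `χ v` on which side of `e` the vertex of the fundamental domain `T` with stabilizer
`G_v` is. It is obtained from an action of `π₁(Γ, T)` on two copies of itself, which are exchanged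
whenever `e` is crossed. -/
theorem IsMaximalTree.exists_side [Finite V] (hT : Γ.IsMaximalTree T) (e : E) :
    ∃ (side : Γ.FundamentalGroup T → ZMod 2) (χ : V → ZMod 2), side 1 = 0 ∧
      (e ∈ T → χ (Γ.src e) ≠ χ (Γ.tgt e)) ∧ (e ∉ T → ∀ v w, χ v = χ w) ∧
      (∀ v h g, side (Γ.vertexMap T v h * g) = side g +
        χ v * (crossing (Γ.edgeSubgroup T e) g +
          crossing (Γ.edgeSubgroup T e) (Γ.vertexMap T v h * g))) ∧
      (∀ f ≠ e, ∀ g, side (Γ.stableMap T f * g) = side g +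
        (χ (Γ.tgt f) * crossing (Γ.edgeSubgroup T e) g +
          χ (Γ.src f) * crossing (Γ.edgeSubgroup T e) (Γ.stableMap T f * g))) ∧
      ∀ g, side (Γ.stableMap T e * g) = side g +
        (χ (Γ.tgt e) * crossing (Γ.edgeSubgroup T e) g +
          (χ (Γ.src e) + 1) * crossing (Γ.edgeSubgroup T e) (Γ.stableMap T e * g)) := by
  classical
  set G := Γ.FundamentalGroup T
  set C := Γ.edgeSubgroup T e
  let ε : E → Multiplicative (ZMod 2) := fun f => Multiplicative.ofAdd (if f = e then 1 else 0)
  obtain ⟨Φ, u, huN, hu, hΦv, hΦs⟩ := hT.exists_hom (H := Equiv.Perm (G × ZMod 2)) (shift C).range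
    (fun v => (translate G).comp (Γ.vertexMap T v))
    (fun f => shift C (ε f) * translate G (Γ.stableMap T f)) (by
      intro f a
      have hcomm : shift C (ε f) * translate G (Γ.vertexMap T _ (Γ.toSrc f a)) =
          translate G (Γ.vertexMap T _ (Γ.toSrc f a)) * shift C (ε f) := by
        by_cases hf : f = e
        · subst hf
          exact commute_shift_translate (C := C) ⟨a, rfl⟩ _
        · simp [ε, hf]
      simp only [MonoidHom.comp_apply, ← Γ.stableMap_conj T f a, map_mul, map_inv]
      rw [mul_inv_rev, mul_assoc, mul_assoc, ← mul_assoc _ (shift C (ε f)), ← hcomm]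
      group) (by
      intro f hf
      rw [Γ.stableMap_eq_one T hf, map_one, mul_one]
      exact ⟨_, rfl⟩)
  choose χ' hχ' using huN
  have neg : ∀ x y : ZMod 2, x - y = x + y := fun x y => by rw [CharTwo.sub_eq_add]
  have hv : ∀ v h p, Φ (Γ.vertexMap T v h) p = (Γ.vertexMap T v h * p.1, p.2 +
      (χ' v).toAdd * (crossing C p.1 + crossing C (Γ.vertexMap T v h * p.1))) := by
    intro v h p
    rw [hΦv, ← hχ', Equiv.Perm.mul_apply, Equiv.Perm.mul_apply, shift_apply, MonoidHom.comp_apply,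
      translate_apply, shift_inv_apply, neg]
    exact Prod.ext rfl (by ring)
  have hs : ∀ f p, Φ (Γ.stableMap T f) p = (Γ.stableMap T f * p.1, p.2 +
      ((χ' (Γ.tgt f)).toAdd * crossing C p.1 +
        ((χ' (Γ.src f)).toAdd + (ε f).toAdd) * crossing C (Γ.stableMap T f * p.1))) := by
    intro f p
    rw [hΦs, ← hχ', ← hχ', Equiv.Perm.mul_apply, Equiv.Perm.mul_apply, Equiv.Perm.mul_apply,
      shift_apply, translate_apply, shift_apply, shift_inv_apply, neg]
    exact Prod.ext rfl (by ring)
  have hfst : ∀ g p, (Φ g p).1 = g * p.1 := by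
    intro g
    have hg : g ∈ Subgroup.closure (Γ.generators T) := by
      rw [Γ.closure_generators]; trivial
    induction hg using Subgroup.closure_induction with
    | mem x hx =>
      obtain ⟨v, h, rfl⟩ | ⟨f, rfl⟩ := hx
      · intro p; rw [hv]
      · intro p; rw [hs]
    | one => intro p; simp
    | mul x y _ _ hx hy => intro p; rw [map_mul, Equiv.Perm.mul_apply, hx, hy, mul_assoc]
    | inv x _ hx =>
      intro p
      have := hx (Φ x⁻¹ p)
      rw [← Equiv.Perm.mul_apply, ← map_mul, mul_inv_cancel, map_one, Equiv.Perm.one_apply] at this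
      rw [this, inv_mul_cancel_left]
  have htree : ∀ f ∈ T, χ' (Γ.src f) = ε f * χ' (Γ.tgt f) := by
    intro f hf
    apply shift_injective C
    rw [map_mul, hχ', hχ', hu f hf, Γ.stableMap_eq_one T hf, map_one, mul_one]
  have hstep : ∀ x g, Φ (x * g) (1, 0) = Φ x (g, (Φ g (1, 0)).2) := by
    intro x g
    rw [map_mul, Equiv.Perm.mul_apply]
    congr 1
    exact Prod.ext (by rw [hfst, mul_one]) rfl
  refine ⟨fun g => (Φ g (1, 0)).2, fun v => (χ' v).toAdd, by simp, ?_, ?_, ?_, ?_, ?_⟩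
  · intro he h
    simp only at h
    have := congrArg Multiplicative.toAdd (htree e he)
    simp only [toAdd_mul] at this
    rw [h] at this
    simp [ε] at this
  · intro he v w
    by_contra hne
    obtain ⟨f, hf, hcase⟩ := hT.1.exists_boundary_edge (S := {x | (χ' x).toAdd = (χ' v).toAdd})
      (x := v) (y := w) rfl (fun h => hne (Eq.symm h))
    have hfe : f ≠ e := fun h => he (h ▸ hf)
    have := htree f hf
    simp only [ε, hfe, if_false, ofAdd_zero, one_mul] at this
    simp only [Set.mem_ofPred_eq, this] at hcase
    tauto
  · intro v h g
    simp only [hstep, hv]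
  · intro f hf g
    simp only [hstep, hs]
    simp [ε, hf]
  · intro g
    simp only [hstep, hs]
    simp [ε]

end Side

/-! ### Elements outside an edge group -/

section Witness

variable {V E : Type*} {Γ : GraphOfGroups V E} {T : Set E}

theorem mem_edgeSubgroup_iff {e : E} {g : Γ.FundamentalGroup T} :
    g ∈ Γ.edgeSubgroup T e ↔ ∃ a, Γ.vertexMap T (Γ.src e) (Γ.toSrc e a) = g := Iff.rfl

theorem stableMap_conj_mem_edgeSubgroup_iff {e : E} {g : Γ.FundamentalGroup T} :
    Γ.stableMap T e * g * (Γ.stableMap T e)⁻¹ ∈ Γ.edgeSubgroup T e ↔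
      ∃ a, Γ.vertexMap T (Γ.tgt e) (Γ.toTgt e a) = g := by
  rw [mem_edgeSubgroup_iff]
  refine exists_congr fun a => ?_
  rw [← Γ.stableMap_conj T e a]
  constructor
  · intro h
    rw [h]; group
  · rintro rfl
    group

theorem mem_edgeSubgroup_iff_of_mem {e : E} (he : e ∈ T) {g : Γ.FundamentalGroup T} :
    g ∈ Γ.edgeSubgroup T e ↔ ∃ a, Γ.vertexMap T (Γ.tgt e) (Γ.toTgt e a) = g := by
  rw [← stableMap_conj_mem_edgeSubgroup_iff, Γ.stableMap_eq_one T he]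
  simp

theorem IsMaximalTree.vertexMap_src_notMem [Finite V] (hT : Γ.IsMaximalTree T) {e : E}
    {h : Γ.vertexGroup (Γ.src e)} (hh : h ∉ (Γ.toSrc e).range) :
    Γ.vertexMap T (Γ.src e) h ∉ Γ.edgeSubgroup T e := by
  rintro ⟨a, ha⟩
  exact hh ⟨a, hT.vertexMap_injective _ ha⟩

theorem IsMaximalTree.vertexMap_tgt_notMem [Finite V] (hT : Γ.IsMaximalTree T) {e : E}
    {h : Γ.vertexGroup (Γ.tgt e)} (hh : h ∉ (Γ.toTgt e).range) :
    ¬ ∃ a, Γ.vertexMap T (Γ.tgt e) (Γ.toTgt e a) = Γ.vertexMap T (Γ.tgt e) h := by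
  rintro ⟨a, ha⟩
  exact hh ⟨a, hT.vertexMap_injective _ ha⟩

/-- The groups of the two ends of an edge `e` of the tree meet only in the edge group: elements of
these groups which are not in the edge group are on different sides of `e`. -/
theorem IsMaximalTree.vertexMap_src_ne_vertexMap_tgt [Finite V] (hT : Γ.IsMaximalTree T) {e : E}
    (he : e ∈ T) (h : Γ.vertexGroup (Γ.src e)) (k : Γ.vertexGroup (Γ.tgt e))
    (hC : Γ.vertexMap T _ h ∉ Γ.edgeSubgroup T e) :
    Γ.vertexMap T _ h ≠ Γ.vertexMap T _ k := by
  intro heq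
  obtain ⟨side, χ, h1, hχ, -, hv, -⟩ := hT.exists_side e
  have e1 := hv _ h 1
  have e2 := hv _ k 1
  rw [← heq] at e2
  rw [mul_one, h1, crossing_of_mem (one_mem _), crossing_of_notMem hC] at e1 e2
  exact hχ he (by simpa using e1.symm.trans e2)

/-- In a reduced graph of groups which is not an ascending HNN-extension, if one of the embeddings
of the group of an edge `e` is onto, then (`e` is a loop, and) some other generator of the
fundamental group is not in the vertex group at `e`. -/
theorem IsMaximalTree.exists_generator_notMem_range [Finite V] [Finite E] (hT : Γ.IsMaximalTree T)
    (hred : Γ.IsReduced) (hasc : ¬ Γ.IsAscendingHNN) {e : E}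
    (hsurj : Function.Surjective (Γ.toSrc e) ∨ Function.Surjective (Γ.toTgt e)) :
    ∃ x, ((∃ v h, x = Γ.vertexMap T v h) ∨ ∃ f ≠ e, x = Γ.stableMap T f) ∧
      ∀ h, Γ.vertexMap T (Γ.src e) h ≠ x := by
  by_cases hV : ∃ w, w ≠ Γ.src e
  · obtain ⟨w, hw⟩ := hV
    obtain ⟨f, hf, ⟨h1, -⟩ | ⟨-, h2⟩⟩ := hT.1.exists_boundary_edge (S := {Γ.src e}) rfl hw
    · obtain ⟨c, hc⟩ := not_forall.1 (hred f (hT.src_ne_tgt hf)).2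
      refine ⟨_, Or.inl ⟨_, c, rfl⟩, ?_⟩
      rw [← (show Γ.src f = Γ.src e from h1)]
      intro h heq
      refine hT.vertexMap_src_ne_vertexMap_tgt hf h c ?_ heq
      rw [heq, mem_edgeSubgroup_iff_of_mem hf]
      exact hT.vertexMap_tgt_notMem hc
    · obtain ⟨c, hc⟩ := not_forall.1 (hred f (hT.src_ne_tgt hf)).1
      refine ⟨_, Or.inl ⟨_, c, rfl⟩, ?_⟩
      rw [← (show Γ.tgt f = Γ.src e from h2)]
      intro h heq
      exact hT.vertexMap_src_ne_vertexMap_tgt hf c h (hT.vertexMap_src_notMem hc) heq.symm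
  · push Not at hV
    have hcardV : Nat.card V = 1 := Nat.card_eq_one_iff_exists.2 ⟨_, hV⟩
    have hE : ∃ f, f ≠ e := by
      by_contra! h
      exact hasc ⟨hcardV, Nat.card_eq_one_iff_exists.2 ⟨e, h⟩, e, hsurj⟩
    obtain ⟨f, hf⟩ := hE
    refine ⟨_, Or.inr ⟨f, hf, rfl⟩, fun h heq => ?_⟩
    -- There is only one vertex, so `T` is empty and `π₁(Γ, T)` maps to `ℤ` by `t_f ↦ 1`.
    obtain ⟨Φ, h1, h2⟩ := Γ.exists_lift T (H := Multiplicative ℤ) (fun _ => 1)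
      (fun _ => Multiplicative.ofAdd 1) (by simp)
      (fun f hf => absurd ((hV _).trans (hV _).symm) (hT.src_ne_tgt hf))
    have := congrArg Φ heq
    rw [h1, h2, MonoidHom.one_apply] at this
    exact absurd this (by decide)

end Witness

end GraphOfGroups

/-! ### Characters which vanish on an edge group -/

namespace BNS

theorem Character.val_one {G : Type*} [Group G] (φ : Character G) : φ.val 1 = 0 := map_zero φ

theorem Character.val_mul {G : Type*} [Group G] (φ : Character G) (g h : G) :
    φ.val (g * h) = φ.val g + φ.val h := map_add φ _ _

theorem Character.val_inv {G : Type*} [Group G] (φ : Character G) (g : G) :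
    φ.val g⁻¹ = -φ.val g := map_neg φ _

theorem Character.val_pow {G : Type*} [Group G] (φ : Character G) (g : G) (n : ℕ) :
    φ.val (g ^ n) = n * φ.val g := by
  rw [← nsmul_eq_mul]
  exact map_nsmul φ n _

/-- The composite of a character with a homomorphism of groups. -/
abbrev Character.restrict {G H : Type*} [Group G] [Group H] (φ : Character G) (f : H →* G) :
    Character H :=
  φ.comp (MonoidHom.toAdditive f)

theorem Character.restrict_val {G H : Type*} [Group G] [Group H] (φ : Character G) (f : H →* G)
    (h : H) : (φ.restrict f).val h = φ.val (f h) := rfl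

theorem Character.exists_val_ne_zero {G : Type*} [Group G] {φ : Character G} (hφ : φ ≠ 0)
    {X : Set G} (hX : Subgroup.closure X = ⊤) : ∃ x ∈ X, φ.val x ≠ 0 := by
  by_contra! h
  have key : ∀ g ∈ Subgroup.closure X, φ.val g = 0 := by
    intro g hg
    induction hg using Subgroup.closure_induction with
    | mem x hx => exact h x hx
    | one => exact φ.val_one
    | mul x y _ _ hx hy => rw [φ.val_mul, hx, hy, add_zero]
    | inv x _ hx => rw [φ.val_inv, hx, neg_zero]
  exact hφ (DFunLike.ext _ _ fun g => key g.toMul (by rw [hX]; trivial))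

theorem Character.exists_lt_val {G : Type*} [Group G] {φ : Character G} (hφ : φ ≠ 0) (r : ℝ) :
    ∃ g, r < φ.val g := by
  obtain ⟨x, -, hx⟩ := φ.exists_val_ne_zero hφ (X := Set.univ) Subgroup.closure_univ
  have key : ∀ y, 0 < φ.val y → ∃ g, r < φ.val g := fun y hy => by
    obtain ⟨n, hn⟩ := exists_nat_gt (r / φ.val y)
    exact ⟨y ^ n, by rwa [φ.val_pow, ← div_lt_iff₀ hy]⟩
  rcases hx.lt_or_gt with h | h
  · exact key x⁻¹ (by rw [φ.val_inv]; linarith)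
  · exact key x h

theorem nonnegCayley_adj {G : Type*} [Group G] {S : Set G} {φ : Character G}
    {x y : {g : G | 0 ≤ φ.val g}} :
    (nonnegCayley S φ).Adj x y ↔ x.1 ≠ y.1 ∧ ∃ s ∈ S, x.1 * s = y.1 ∨ x.1 = y.1 * s :=
  SimpleGraph.mulCayley_adj' S x.1 y.1

/-- If `Cay(G, S)^{[0, ∞)}` is connected, a function of `g⁻¹` which, along each kind of edge,
changes only at bounded height is constant at all large heights: a translate of
`Cay(G, S)^{[0, ∞)}` avoids all the changes. -/
theorem eventually_const_of_connected {G α : Type*} [Group G] {φ : Character G} (hφ : φ ≠ 0)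
    {S : Set G} (hS : S.Finite) (hconn : (nonnegCayley S φ).Connected) (f : G → α)
    (hf : ∀ s ∈ S, ∃ M, ∀ g, M < |φ.val g| → f (s * g) = f g) :
    ∃ M, ∀ g g', φ.val g < M → φ.val g' < M → f g = f g' := by
  choose! B hB using hf
  obtain ⟨M, hM⟩ := (hS.image B).bddAbove
  obtain ⟨z, hz⟩ := φ.exists_lt_val hφ (max M 0)
  obtain ⟨hz1, hz2⟩ := max_lt_iff.1 hz
  have hfS : ∀ s ∈ S, ∀ x, 0 ≤ φ.val x → f (s * (z * x)⁻¹) = f (z * x)⁻¹ := by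
    intro s hs x hx
    apply hB s hs
    have h1 : B s ≤ M := hM ⟨s, hs, rfl⟩
    have h2 := neg_le_abs (φ.val (z * x)⁻¹)
    rw [φ.val_inv, φ.val_mul] at h2
    rw [φ.val_inv, φ.val_mul]
    linarith
  have hadj : ∀ x y, (nonnegCayley S φ).Adj x y → f (z * x.1)⁻¹ = f (z * y.1)⁻¹ := by
    intro x y h
    obtain ⟨-, s, hs, h | h⟩ := nonnegCayley_adj.1 h
    · rw [← hfS s hs y.1 y.2, ← h]
      congr 1; group
    · rw [← hfS s hs x.1 x.2, h]
      congr 1; group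
  have hwalk : ∀ x y : {g : G | 0 ≤ φ.val g}, f (z * x.1)⁻¹ = f (z * y.1)⁻¹ := by
    intro x y
    obtain ⟨p⟩ := hconn.preconnected x y
    induction p with
    | nil => rfl
    | cons h _ ih => exact (hadj _ _ h).trans ih
  refine ⟨-φ.val z, fun g g' hg hg' => ?_⟩
  have hmem : ∀ g, φ.val g < -φ.val z → 0 ≤ φ.val (z⁻¹ * g⁻¹) := fun g hg => by
    rw [φ.val_mul, φ.val_inv, φ.val_inv]; linarith
  simpa using hwalk ⟨_, hmem g hg⟩ ⟨_, hmem g' hg'⟩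

/-- Let `C` be a subgroup on which `φ` vanishes, and suppose that `side` changes, under left
multiplication by a generator, only on entering or leaving `C`. From a point outside `C` one can
descend to height `-∞`, by the powers of a generator, without meeting `C` again. -/
theorem side_eq_of_connected {G α : Type*} [Group G] {C : Subgroup G} {X : Set G}
    (hX : Subgroup.closure X = ⊤) {side : G → α}
    (hside : ∀ x ∈ X, ∀ g ∉ C, x * g ∉ C → side (x * g) = side g)
    {φ : Character G} (hφ : φ ≠ 0) (hC : ∀ c ∈ C, φ.val c = 0)
    {S : Set G} (hS : S.Finite) (hconn : (nonnegCayley S φ).Connected)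
    {g g' : G} (hg : g ∉ C) (hg0 : φ.val g ≤ 0) (hg' : g' ∉ C) (hg0' : φ.val g' ≤ 0) :
    side g = side g' := by
  have hbound : ∀ x, ∃ M, ∀ g, M < |φ.val g| → side (x * g) = side g := by
    intro x
    have hx : x ∈ Subgroup.closure X := by rw [hX]; trivial
    induction hx using Subgroup.closure_induction with
    | mem x hx =>
      refine ⟨|φ.val x|, fun g hg => hside x hx g (fun h => ?_) (fun h => ?_)⟩
      · rw [hC g h, abs_zero] at hg
        exact absurd hg (not_lt.2 (abs_nonneg _))
      · have := hC _ h
        rw [φ.val_mul, add_eq_zero_iff_eq_neg] at this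
        rw [this, abs_neg] at hg
        exact lt_irrefl _ hg
    | one => exact ⟨0, fun g _ => by rw [one_mul]⟩
    | mul x y _ _ hx hy =>
      obtain ⟨M, hM⟩ := hx
      obtain ⟨M', hM'⟩ := hy
      refine ⟨max (M + |φ.val y|) M', fun g hg => ?_⟩
      obtain ⟨h1, h2⟩ := max_lt_iff.1 hg
      rw [mul_assoc, hM, hM' g h2]
      have := abs_sub_abs_le_abs_sub (φ.val g) (-φ.val y)
      rw [abs_neg, sub_neg_eq_add] at this
      rw [φ.val_mul, add_comm]
      linarith
    | inv x _ hx =>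
      obtain ⟨M, hM⟩ := hx
      refine ⟨M + |φ.val x|, fun g hg => ?_⟩
      have := hM (x⁻¹ * g) (by
        have := abs_sub_abs_le_abs_sub (φ.val g) (φ.val x)
        rw [φ.val_mul, φ.val_inv, add_comm, ← sub_eq_add_neg]
        linarith)
      rw [mul_inv_cancel_left] at this
      exact this.symm
  obtain ⟨M, hM⟩ := eventually_const_of_connected hφ hS hconn side (fun s _ => hbound s)
  obtain ⟨s, hs, hs0⟩ : ∃ s, (∀ g ∉ C, s * g ∉ C → side (s * g) = side g) ∧ φ.val s < 0 := by
    obtain ⟨x, hx, hx0⟩ := φ.exists_val_ne_zero hφ hX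
    rcases hx0.lt_or_gt with h | h
    · exact ⟨x, hside x hx, h⟩
    · refine ⟨x⁻¹, fun g h1 h2 => ?_, by rw [φ.val_inv]; linarith⟩
      have := hside x hx (x⁻¹ * g) h2 (by rwa [mul_inv_cancel_left])
      rw [mul_inv_cancel_left] at this
      exact this.symm
  have descend : ∀ g ∉ C, φ.val g ≤ 0 → ∃ p, φ.val p < M ∧ side p = side g := by
    intro g hg hg0
    have hpow : ∀ n : ℕ, s ^ n * g ∉ C ∧ side (s ^ n * g) = side g := by
      intro n
      induction n with
      | zero => simpa using hg
      | succ n ih =>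
        have hmem : s ^ (n + 1) * g ∉ C := fun h => by
          have := hC _ h
          rw [φ.val_mul, φ.val_pow] at this
          have h1 : ((n + 1 : ℕ) : ℝ) * φ.val s < 0 := mul_neg_of_pos_of_neg (by positivity) hs0
          linarith
        refine ⟨hmem, ?_⟩
        rw [pow_succ', mul_assoc] at hmem ⊢
        rw [hs _ ih.1 hmem, ih.2]
    obtain ⟨n, hn⟩ := exists_nat_gt (M / φ.val s)
    refine ⟨s ^ n * g, ?_, (hpow n).2⟩
    rw [div_lt_iff_of_neg hs0] at hn
    rw [φ.val_mul, φ.val_pow]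
    linarith
  obtain ⟨p, hp, hp1⟩ := descend g hg hg0
  obtain ⟨p', hp', hp1'⟩ := descend g' hg' hg0'
  rw [← hp1, ← hp1', hM p p' hp hp']

end BNS

namespace GraphOfGroups

variable {V E : Type*} {Γ : GraphOfGroups V E} {T : Set E}

theorem exists_notMem_val_nonpos {G H : Type*} [Group G] [Group H] (φ : BNS.Character G)
    (f : H →* G) {D : Subgroup H} (hD : ∃ h, h ∉ D) : ∃ h, h ∉ D ∧ φ.val (f h) ≤ 0 := by
  obtain ⟨h, hh⟩ := hD
  rcases le_total (φ.val (f h)) 0 with h0 | h0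
  · exact ⟨h, hh, h0⟩
  · exact ⟨h⁻¹, fun h' => hh (inv_mem_iff.1 h'), by rw [map_inv, φ.val_inv]; linarith⟩

/-- A non-zero character which vanishes on an edge group is not in the invariant: on both sides of
the edge there are points outside the edge group at height at most `0`. -/
theorem IsMaximalTree.not_connected [Finite V] [Finite E] (hT : Γ.IsMaximalTree T)
    (hred : Γ.IsReduced) (hasc : ¬ Γ.IsAscendingHNN) (e : E)
    {φ : BNS.Character (Γ.FundamentalGroup T)} (hφ : φ ≠ 0)
    (hC : ∀ a, φ.val (Γ.edgeMap T e a) = 0) {S : Set (Γ.FundamentalGroup T)} (hS : S.Finite) :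
    ¬ (BNS.nonnegCayley S φ).Connected := by
  intro hconn
  obtain ⟨side, χ, h1, hχ, hχ', hv, hs, hse⟩ := hT.exists_side e
  have hgen : ∀ x ∈ Γ.generators T, ∀ g ∉ Γ.edgeSubgroup T e, x * g ∉ Γ.edgeSubgroup T e →
      side (x * g) = side g := by
    rintro x (⟨v, h, rfl⟩ | ⟨f, rfl⟩) g hg hxg
    · rw [hv, crossing_of_notMem hg, crossing_of_notMem hxg]; ring
    · by_cases hf : f = e
      · subst hf
        rw [hse, crossing_of_notMem hg, crossing_of_notMem hxg]; ring
      · rw [hs f hf, crossing_of_notMem hg, crossing_of_notMem hxg]; ring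
  have hC' : ∀ c ∈ Γ.edgeSubgroup T e, φ.val c = 0 := by
    rintro _ ⟨a, rfl⟩
    exact hC a
  by_cases he : e ∈ T
  · obtain ⟨hr1, hr2⟩ := hred e (hT.src_ne_tgt he)
    obtain ⟨a, ha, ha0⟩ := exists_notMem_val_nonpos φ (Γ.vertexMap T (Γ.src e))
      (D := (Γ.toSrc e).range) (not_forall.1 hr1)
    obtain ⟨b, hb, hb0⟩ := exists_notMem_val_nonpos φ (Γ.vertexMap T (Γ.tgt e))
      (D := (Γ.toTgt e).range) (not_forall.1 hr2)
    have ha' := hT.vertexMap_src_notMem ha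
    have hb' : Γ.vertexMap T (Γ.tgt e) b ∉ Γ.edgeSubgroup T e := by
      rw [mem_edgeSubgroup_iff_of_mem he]
      exact hT.vertexMap_tgt_notMem hb
    have heq := BNS.side_eq_of_connected (Γ.closure_generators T) hgen hφ hC' hS hconn
      ha' ha0 hb' hb0
    have e1 := hv _ a 1
    have e2 := hv _ b 1
    rw [mul_one, h1, crossing_of_mem (one_mem _), crossing_of_notMem ha'] at e1
    rw [mul_one, h1, crossing_of_mem (one_mem _), crossing_of_notMem hb'] at e2
    rw [e1, e2] at heq
    exact hχ he (by simpa using heq)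
  · obtain ⟨k, hk⟩ : ∃ k, ∀ v, χ v = k := ⟨χ (Γ.src e), fun v => hχ' he _ _⟩
    simp only [hk] at hv hs hse
    have char_two : ∀ x : ZMod 2, x + x = 0 := CharTwo.add_self_eq_zero
    -- The subgroup `A` of the elements which do not cross `e`.
    let A : Subgroup (Γ.FundamentalGroup T) :=
      { carrier := {x | ∀ g, side (x * g) = side g +
          k * (crossing (Γ.edgeSubgroup T e) g + crossing (Γ.edgeSubgroup T e) (x * g))}
        one_mem' := fun g => by rw [one_mul, char_two, mul_zero, add_zero]
        mul_mem' := fun {x y} hx hy g => by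
          rw [mul_assoc, hx, hy]
          linear_combination k * char_two (crossing (Γ.edgeSubgroup T e) (y * g))
        inv_mem' := fun {x} hx g => by
          have := hx (x⁻¹ * g)
          rw [mul_inv_cancel_left] at this
          rw [this, add_assoc, ← mul_add, add_comm (crossing (Γ.edgeSubgroup T e) g), char_two,
            mul_zero, add_zero] }
    have hA : ∀ x, ((∃ v h, x = Γ.vertexMap T v h) ∨ ∃ f ≠ e, x = Γ.stableMap T f) → x ∈ A := by
      rintro x (⟨v, h, rfl⟩ | ⟨f, hf, rfl⟩)
      · exact hv v h
      · intro g
        rw [hs f hf]; ring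
    set t := Γ.stableMap T e with ht
    obtain ⟨x, hx, hx'⟩ : ∃ x ∈ A, x ∉ Γ.edgeSubgroup T e := by
      by_cases hsurj : Function.Surjective (Γ.toSrc e)
      · obtain ⟨x, hx, hx'⟩ := hT.exists_generator_notMem_range hred hasc (Or.inl hsurj)
        exact ⟨x, hA x hx, fun ⟨a, ha⟩ => hx' _ ha⟩
      · obtain ⟨a, ha⟩ := not_forall.1 hsurj
        exact ⟨_, hA _ (Or.inl ⟨_, a, rfl⟩), hT.vertexMap_src_notMem ha⟩
    obtain ⟨y, hy, hy'⟩ : ∃ y ∈ A, t * y * t⁻¹ ∉ Γ.edgeSubgroup T e := by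
      simp only [ht, stableMap_conj_mem_edgeSubgroup_iff]
      by_cases hsurj : Function.Surjective (Γ.toTgt e)
      · have hloop : Γ.src e = Γ.tgt e := by
          by_contra hne
          exact (hred e hne).2 hsurj
        obtain ⟨y, hy, hy'⟩ := hT.exists_generator_notMem_range hred hasc (Or.inr hsurj)
        rw [hloop] at hy'
        exact ⟨y, hA y hy, fun ⟨a, ha⟩ => hy' _ ha⟩
      · obtain ⟨b, hb⟩ := not_forall.1 hsurj
        exact ⟨_, hA _ (Or.inl ⟨_, b, rfl⟩), hT.vertexMap_tgt_notMem hb⟩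
    obtain ⟨⟨x, hx⟩, hxC, hx0⟩ := exists_notMem_val_nonpos φ A.subtype
      (D := (Γ.edgeSubgroup T e).subgroupOf A) ⟨⟨x, hx⟩, hx'⟩
    obtain ⟨⟨y, hy⟩, hyC, hy0⟩ := exists_notMem_val_nonpos φ ((MulAut.conj t).toMonoidHom.comp
      A.subtype) (D := ((Γ.edgeSubgroup T e).comap (MulAut.conj t).toMonoidHom).subgroupOf A)
      ⟨⟨y, hy⟩, hy'⟩
    replace hxC : x ∉ Γ.edgeSubgroup T e := hxC
    replace hyC : t * y * t⁻¹ ∉ Γ.edgeSubgroup T e := hyC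
    have heq := BNS.side_eq_of_connected (Γ.closure_generators T) hgen hφ hC' hS hconn
      hxC hx0 hyC hy0
    have e1 := hx 1
    have e2 := hse t⁻¹
    have e3 := hy t⁻¹
    have e4 := hse (y * t⁻¹)
    rw [mul_one, h1, crossing_of_mem (one_mem _), crossing_of_notMem hxC] at e1
    rw [mul_inv_cancel, h1, crossing_of_mem (one_mem _)] at e2
    rw [← mul_assoc, crossing_of_notMem hyC] at e4
    rw [e1, e4, e3] at heq
    have h01 : (1 : ZMod 2) = 0 := by
      linear_combination heq - e2 + k * char_two (crossing (Γ.edgeSubgroup T e) (y * t⁻¹)) -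
        char_two k
    exact absurd h01 (by decide)

end GraphOfGroups

/-! ### Characters which are non-trivial on all edge groups -/

namespace BNS

theorem exists_pos_of_toSphere_eq {G : Type*} [Group G] {φ ψ : Character G} {hφ : φ ≠ 0}
    {hψ : ψ ≠ 0} (h : toSphere φ hφ = toSphere ψ hψ) :
    ∃ r : ℝ, 0 < r ∧ ∀ g, ψ.val g = r * φ.val g := by
  obtain ⟨r, hr, h⟩ := ((ray_eq_iff hφ hψ).1 h).exists_pos_left hφ hψ
  exact ⟨r, hr, fun g => by rw [← h]; rfl⟩

theorem toSphere_mem_sigmaSet_iff {G : Type*} [Group G] {φ : Character G} (hφ : φ ≠ 0) :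
    toSphere φ hφ ∈ sigmaSet G ↔
      ∃ S : Set G, S.Finite ∧ Subgroup.closure S = ⊤ ∧ (nonnegCayley S φ).Connected := by
  refine ⟨?_, fun h => ⟨φ, hφ, rfl, h⟩⟩
  rintro ⟨ψ, hψ, h, S, hS, hS', hconn⟩
  obtain ⟨r, hr, h⟩ := exists_pos_of_toSphere_eq h
  refine ⟨S, hS, hS', ?_⟩
  have hset : {g : G | 0 ≤ φ.val g} = {g : G | 0 ≤ ψ.val g} := by
    ext g
    simp only [Set.mem_ofPred_eq, h, mul_nonneg_iff_of_pos_left hr]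
  unfold nonnegCayley at hconn ⊢
  rwa [hset]

theorem toSphere_mem_subsphere_iff {G : Type*} [Group G] {φ : Character G} (hφ : φ ≠ 0)
    {H : Subgroup G} : toSphere φ hφ ∈ subsphere H ↔ ∀ h ∈ H, φ.val h = 0 := by
  refine ⟨?_, fun h => ⟨φ, hφ, rfl, h⟩⟩
  rintro ⟨ψ, hψ, heq, h⟩ g hg
  obtain ⟨r, -, hr⟩ := exists_pos_of_toSphere_eq heq
  rw [hr, h g hg, mul_zero]

/-- `x` and `y` are joined by a path in `Cay(G, S)^{[0, ∞)}`. -/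
def Joined {G : Type*} [Group G] (S : Set G) (φ : Character G) (x y : G) : Prop :=
  ∃ (hx : 0 ≤ φ.val x) (hy : 0 ≤ φ.val y), (nonnegCayley S φ).Reachable ⟨x, hx⟩ ⟨y, hy⟩

theorem Joined.refl {G : Type*} [Group G] {S : Set G} {φ : Character G} {x : G}
    (hx : 0 ≤ φ.val x) : Joined S φ x x := ⟨hx, hx, SimpleGraph.Reachable.refl _⟩

theorem Joined.symm {G : Type*} [Group G] {S : Set G} {φ : Character G} {x y : G}
    (h : Joined S φ x y) : Joined S φ y x := ⟨h.2.1, h.1, h.2.2.symm⟩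

theorem Joined.trans {G : Type*} [Group G] {S : Set G} {φ : Character G} {x y z : G}
    (h : Joined S φ x y) (h' : Joined S φ y z) : Joined S φ x z :=
  ⟨h.1, h'.2.1, h.2.2.trans h'.2.2⟩

theorem Joined.mul_right {G : Type*} [Group G] {S : Set G} {φ : Character G} {x s : G}
    (hs : s ∈ S) (hx : 0 ≤ φ.val x) (hxs : 0 ≤ φ.val (x * s)) : Joined S φ x (x * s) := by
  by_cases h : x = x * s
  · rw [← h]
    exact Joined.refl hx
  · exact ⟨hx, hxs, SimpleGraph.Adj.reachable (nonnegCayley_adj.2 ⟨h, s, hs, Or.inl rfl⟩)⟩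

/-- If the restriction of `φ` to `H` is in the invariant of `H`, the part of each coset `g f(H)`
where `φ ≥ 0` is connected: above the lower of two of its points it is a translate of the part of
`H` where `φ ≥ 0`. -/
theorem Joined.of_connected {G H : Type*} [Group G] [Group H] {S : Set G} {φ : Character G}
    {f : H →* G} {S' : Set H} (hS : ∀ s ∈ S', f s ∈ S)
    (hconn : (nonnegCayley S' (φ.restrict f)).Connected) (g : G) {h h' : H}
    (hh : 0 ≤ φ.val (g * f h)) (hh' : 0 ≤ φ.val (g * f h')) :
    Joined S φ (g * f h) (g * f h') := by
  wlog hle : φ.val (f h) ≤ φ.val (f h') generalizing h h'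
  · exact (this hh' hh (le_of_not_ge hle)).symm
  have key : ∀ x y : {k : H | 0 ≤ (φ.restrict f).val k},
      Joined S φ (g * f h * f x.1) (g * f h * f y.1) := by
    have hpos : ∀ x : {k : H | 0 ≤ (φ.restrict f).val k}, 0 ≤ φ.val (g * f h * f x.1) := fun x => by
      rw [φ.val_mul]
      exact add_nonneg hh x.2
    intro x y
    obtain ⟨p⟩ := hconn.preconnected x y
    induction p with
    | nil => exact Joined.refl (hpos _)
    | @cons x y z hxy _ ih =>
      refine Joined.trans ?_ ih
      obtain ⟨-, s, hs, hs' | hs'⟩ := nonnegCayley_adj.1 hxy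
      · have hy := hpos y
        rw [← hs', map_mul, ← mul_assoc] at hy ⊢
        exact Joined.mul_right (hS s hs) (hpos x) hy
      · have hx := hpos x
        rw [hs', map_mul, ← mul_assoc] at hx ⊢
        exact (Joined.mul_right (hS s hs) (hpos y) hx).symm
  have := key ⟨1, (φ.restrict f).val_one.ge⟩ ⟨h⁻¹ * h', by
    rw [Set.mem_ofPred_eq, φ.restrict_val, map_mul, map_inv, φ.val_mul, φ.val_inv]; linarith⟩
  simpa using this

end BNS

namespace GraphOfGroups

variable {V E : Type*} {Γ : GraphOfGroups V E} {T : Set E}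

theorem closure_iUnion_generators {S : ∀ v, Set (Γ.vertexGroup v)}
    (hS : ∀ v, Subgroup.closure (S v) = ⊤) :
    Subgroup.closure ((⋃ v, Γ.vertexMap T v '' S v) ∪ Set.range (Γ.stableMap T)) = ⊤ := by
  rw [eq_top_iff, ← Γ.closure_generators T, Subgroup.closure_le]
  rintro x (⟨v, h, rfl⟩ | ⟨e, rfl⟩)
  · have h1 : Γ.vertexMap T v h ∈ (Subgroup.closure (S v)).map (Γ.vertexMap T v) :=
      ⟨h, by rw [hS]; trivial, rfl⟩
    rw [MonoidHom.map_closure] at h1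
    exact Subgroup.closure_mono ((Set.subset_iUnion (fun v => Γ.vertexMap T v '' S v) v).trans
      Set.subset_union_left) h1
  · exact Subgroup.subset_closure (Or.inr ⟨e, rfl⟩)

theorem val_vertexMap_tgt (φ : BNS.Character (Γ.FundamentalGroup T)) (e : E) (a : Γ.edgeGroup e) :
    φ.val (Γ.vertexMap T (Γ.tgt e) (Γ.toTgt e a)) = φ.val (Γ.edgeMap T e a) := by
  rw [← Γ.stableMap_conj, φ.val_mul, φ.val_mul, φ.val_inv]
  change _ + φ.val (Γ.edgeMap T e a) + _ = _
  ring

theorem ConnectedBy.restrict_vertexMap_ne_zero (hT : Γ.ConnectedBy T)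
    {φ : BNS.Character (Γ.FundamentalGroup T)} (hφ : φ ≠ 0)
    (hedge : ∀ e, ∃ a, φ.val (Γ.edgeMap T e a) ≠ 0) (v : V) :
    φ.restrict (Γ.vertexMap T v) ≠ 0 := by
  intro h0
  have hval : ∀ k, φ.val (Γ.vertexMap T v k) = 0 := fun k => DFunLike.congr_fun h0 (.ofMul k)
  have hsrc : ∀ e, Γ.src e ≠ v := by
    rintro e rfl
    obtain ⟨a, ha⟩ := hedge e
    exact ha (hval _)
  have htgt : ∀ e, Γ.tgt e ≠ v := by
    rintro e rfl
    obtain ⟨a, ha⟩ := hedge e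
    rw [← val_vertexMap_tgt] at ha
    exact ha (hval _)
  have hV : ∀ w, w = v := by
    intro w
    by_contra hw
    obtain ⟨e, -, ⟨h, -⟩ | ⟨-, h⟩⟩ := hT.exists_boundary_edge (S := {v}) rfl hw
    · exact hsrc e h
    · exact htgt e h
  obtain ⟨x, ⟨w, k, rfl⟩ | ⟨e, rfl⟩, hx⟩ := φ.exists_val_ne_zero hφ (Γ.closure_generators T)
  · obtain rfl := hV w
    exact hx (hval k)
  · exact hsrc e (hV _)

/-- A character which is non-trivial on all edge groups, and whose restrictions to the vertex groups
are in their invariants, is in the invariant: the parts where `φ ≥ 0` of the cosets of the vertex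
groups are connected, and those of two cosets which are adjacent in the Bass-Serre tree meet (up to
the edge labelled `t_e`) because `φ` is unbounded on the edge group. -/
theorem ConnectedBy.connected_nonnegCayley (hT : Γ.ConnectedBy T)
    {φ : BNS.Character (Γ.FundamentalGroup T)}
    (hedge : ∀ e, ∃ a, φ.val (Γ.edgeMap T e a) ≠ 0)
    {S : ∀ v, Set (Γ.vertexGroup v)}
    (hconn : ∀ v, (BNS.nonnegCayley (S v) (φ.restrict (Γ.vertexMap T v))).Connected) :
    (BNS.nonnegCayley ((⋃ v, Γ.vertexMap T v '' S v) ∪ Set.range (Γ.stableMap T)) φ).Connected := by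
  set S' := (⋃ v, Γ.vertexMap T v '' S v) ∪ Set.range (Γ.stableMap T)
  have hS : ∀ v, ∀ s ∈ S v, Γ.vertexMap T v s ∈ S' := fun v s hs =>
    Or.inl (Set.mem_iUnion.2 ⟨v, s, hs, rfl⟩)
  -- The coset `g G_v` is in the component of `1`.
  let Q : Γ.FundamentalGroup T → V → Prop := fun g v => ∀ h, 0 ≤ φ.val (g * Γ.vertexMap T v h) →
    BNS.Joined S' φ 1 (g * Γ.vertexMap T v h)
  have hQ : ∀ g v h, BNS.Joined S' φ 1 (g * Γ.vertexMap T v h) → Q g v := fun g v h hj h' hh' =>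
    hj.trans (BNS.Joined.of_connected (hS v) (hconn v) g hj.2.1 hh')
  have hQ_mul : ∀ g v h, Q g v ↔ Q (g * Γ.vertexMap T v h) v := by
    intro g v h
    constructor
    · intro hq k hk
      rw [mul_assoc, ← map_mul] at hk ⊢
      exact hq _ hk
    · intro hq k hk
      have := hq (h⁻¹ * k)
      rw [mul_assoc, ← map_mul, mul_inv_cancel_left] at this
      exact this hk
  have hQ_stable : ∀ g e, Q g (Γ.src e) ↔ Q (g * Γ.stableMap T e) (Γ.tgt e) := by
    intro g e
    have hne : φ.restrict (Γ.edgeMap T e) ≠ 0 := by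
      obtain ⟨a, ha⟩ := hedge e
      intro h
      rw [← φ.restrict_val, h] at ha
      exact ha rfl
    obtain ⟨c, hc⟩ := BNS.Character.exists_lt_val hne
      (max (-φ.val g) (-φ.val (g * Γ.stableMap T e)))
    rw [φ.restrict_val] at hc
    obtain ⟨hc1, hc2⟩ := max_lt_iff.1 hc
    have hsrc : φ.val (Γ.vertexMap T (Γ.src e) (Γ.toSrc e c)) = φ.val (Γ.edgeMap T e c) := rfl
    have h1 : 0 ≤ φ.val (g * Γ.vertexMap T (Γ.src e) (Γ.toSrc e c)) := by
      rw [φ.val_mul, hsrc]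
      linarith
    have h2 : 0 ≤ φ.val (g * Γ.stableMap T e * Γ.vertexMap T (Γ.tgt e) (Γ.toTgt e c)) := by
      rw [φ.val_mul, val_vertexMap_tgt]
      linarith
    have heq : g * Γ.vertexMap T (Γ.src e) (Γ.toSrc e c) * Γ.stableMap T e =
        g * Γ.stableMap T e * Γ.vertexMap T (Γ.tgt e) (Γ.toTgt e c) := by
      rw [← Γ.stableMap_conj]; group
    have hj : BNS.Joined S' φ (g * Γ.vertexMap T (Γ.src e) (Γ.toSrc e c))
        (g * Γ.stableMap T e * Γ.vertexMap T (Γ.tgt e) (Γ.toTgt e c)) := by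
      rw [← heq] at h2 ⊢
      exact BNS.Joined.mul_right (Or.inr ⟨e, rfl⟩) h1 h2
    exact ⟨fun hq => hQ _ _ _ ((hq _ h1).trans hj), fun hq => hQ _ _ _ ((hq _ h2).trans hj.symm)⟩
  have hQ_const : ∀ g v w, Q g v ↔ Q g w := by
    intro g v w
    by_contra hne
    obtain ⟨e, he, hcase⟩ := hT.exists_boundary_edge (S := {x | Q g v ↔ Q g x}) Iff.rfl hne
    have := hQ_stable g e
    rw [Γ.stableMap_eq_one T he, mul_one] at this
    simp only [Set.mem_ofPred_eq, this] at hcase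
    tauto
  have hQ_all : ∀ x ∈ Subgroup.closure (Γ.generators T), ∀ g v, Q g v ↔ Q (g * x) v := by
    intro x hx
    induction hx using Subgroup.closure_induction with
    | mem x hx =>
      intro g v
      obtain ⟨w, h, rfl⟩ | ⟨e, rfl⟩ := hx
      · rw [hQ_const g v w, hQ_mul g w h, hQ_const _ w v]
      · rw [hQ_const g v (Γ.src e), hQ_stable, hQ_const _ _ v]
    | one => intro g v; rw [mul_one]
    | mul x y _ _ hx hy => intro g v; rw [hx, hy, mul_assoc]
    | inv x _ hx => intro g v; rw [hx (g * x⁻¹), inv_mul_cancel_right]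
  obtain ⟨v⟩ := hT.1
  have hone : BNS.Joined S' φ 1 1 := BNS.Joined.refl (by rw [φ.val_one])
  have hQ_one : Q 1 v := hQ 1 v 1 (by simpa using hone)
  have hjoin : ∀ g, 0 ≤ φ.val g → BNS.Joined S' φ 1 g := by
    intro g hg
    have := (hQ_all g (by rw [Γ.closure_generators]; trivial) 1 v).1 hQ_one 1
    rw [one_mul, map_one, mul_one] at this
    exact this hg
  have : Nonempty {g | 0 ≤ φ.val g} := ⟨⟨1, hone.1⟩⟩
  exact ⟨fun x y => ((hjoin x.1 x.2).symm.trans (hjoin y.1 y.2)).2.2⟩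

end GraphOfGroups

/-! ### Rationality -/

namespace BNS

/-- The characters which vanish on a subgroup. -/
def vanishing {G : Type*} [Group G] (H : Subgroup G) : Submodule ℝ (Character G) where
  carrier := {φ | ∀ h ∈ H, φ.val h = 0}
  zero_mem' _ _ := rfl
  add_mem' {φ ψ} hφ hψ h hh := by
    change φ.val h + ψ.val h = 0
    rw [hφ h hh, hψ h hh, add_zero]
  smul_mem' r φ hφ h hh := by
    change r * φ.val h = 0
    rw [hφ h hh, mul_zero]

/-- A character `φ` of a finitely generated group has a free abelian image of finite rank; its
coordinates with respect to a basis of the image take values in `ℤ`, vanish where `φ` vanishes, and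
span `φ`. -/
theorem isRationalSubspace_vanishing {G : Type*} [Group G] [Group.FG G] (H : Subgroup G) :
    IsRationalSubspace (vanishing H) := by
  refine le_antisymm (Submodule.span_le.2 fun φ hφ => hφ.1) fun φ hφ => ?_
  have : AddGroup.FG φ.range := AddGroup.fg_range φ
  have : Module.Finite ℤ φ.range := Module.Finite.iff_addGroup_fg.2 this
  let b := Module.Free.chooseBasis ℤ φ.range
  let ψ : Module.Free.ChooseBasisIndex ℤ φ.range → Character G := fun i =>
    ((Int.castAddHom ℝ).comp (b.coord i).toAddMonoidHom).comp φ.rangeRestrict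
  have hψ : ∀ i g, (ψ i).val g = (b.repr (φ.rangeRestrict (.ofMul g)) i : ℤ) := fun _ _ => rfl
  have hsum : φ = ∑ i, (b i : ℝ) • ψ i := by
    refine DFunLike.ext _ _ fun g => ?_
    have := congrArg Subtype.val (b.sum_repr (φ.rangeRestrict g))
    rw [AddMonoidHom.finsetSum_apply]
    change _ = φ g at this
    rw [← this]
    push_cast
    refine Finset.sum_congr rfl fun i _ => ?_
    change _ = (b i : ℝ) * (ψ i).val g.toMul
    rw [hψ, mul_comm]
    simp
  rw [hsum]
  refine Submodule.sum_mem _ fun i _ => Submodule.smul_mem _ _ (Submodule.subset_span ⟨?_, ?_⟩)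
  · intro h hh
    have h0 : φ.rangeRestrict (.ofMul h) = 0 := Subtype.ext (hφ h hh)
    rw [hψ, h0]
    simp
  · exact fun g => ⟨(b.repr (φ.rangeRestrict (.ofMul g)) i : ℤ), by rw [hψ]; simp⟩

end BNS

end

theorem corollary2p9 {V E : Type*} [Finite V] [Finite E] (Γ : GraphOfGroups V E)
    (T : Set E) (hT : Γ.IsMaximalTree T)
    (hred : Γ.IsReduced) (hasc : ¬ Γ.IsAscendingHNN)
    (hvert : ∀ x : V, BNS.InVarsigma (Γ.vertexGroup x)) :
    (∀ (φ : BNS.Character (Γ.FundamentalGroup T)) (hφ : φ ≠ 0),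
      BNS.toSphere φ hφ ∈ BNS.sigmaSet (Γ.FundamentalGroup T) ↔
        ∀ e : E, ∃ a : Γ.edgeGroup e, φ.val (Γ.edgeMap T e a) ≠ 0) ∧
    BNS.sigmaSet (Γ.FundamentalGroup T) = -BNS.sigmaSet (Γ.FundamentalGroup T) ∧
    BNS.sigmaSet (Γ.FundamentalGroup T) = ⋂ e : E, (BNS.subsphere (Γ.edgeSubgroup T e))ᶜ ∧
    ∃ 𝒯 : Set (Set (BNS.Sphere (Γ.FundamentalGroup T))), 𝒯.Finite ∧
      (∀ R ∈ 𝒯, BNS.IsRationallyDefined R) ∧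
      BNS.sigmaSet (Γ.FundamentalGroup T) = (⋃₀ 𝒯)ᶜ := by
  have main : ∀ (φ : BNS.Character (Γ.FundamentalGroup T)) (hφ : φ ≠ 0),
      BNS.toSphere φ hφ ∈ BNS.sigmaSet (Γ.FundamentalGroup T) ↔
        ∀ e : E, ∃ a : Γ.edgeGroup e, φ.val (Γ.edgeMap T e a) ≠ 0 := by
    intro φ hφ
    rw [BNS.toSphere_mem_sigmaSet_iff]
    constructor
    · rintro ⟨S, hS, -, hconn⟩ e
      by_contra! hC
      exact hT.not_connected hred hasc e hφ hC hS hconn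
    · intro hedge
      have hne := hT.1.restrict_vertexMap_ne_zero hφ hedge
      choose S hS hS' hconn using fun v => (BNS.toSphere_mem_sigmaSet_iff (hne v)).1
        (by rw [(hvert v).2]; trivial)
      exact ⟨_, (Set.finite_iUnion fun v => (hS v).image _).union (Set.finite_range _),
        GraphOfGroups.closure_iUnion_generators hS', hT.1.connected_nonnegCayley hedge hconn⟩
  have hinter : BNS.sigmaSet (Γ.FundamentalGroup T) =
      ⋂ e : E, (BNS.subsphere (Γ.edgeSubgroup T e))ᶜ := by
    ext ξ
    induction ξ using Module.Ray.ind with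
    | h φ hφ =>
      refine (main φ hφ).trans ?_
      rw [Set.mem_iInter]
      refine forall_congr' fun e => ?_
      rw [Set.mem_compl_iff, BNS.toSphere_mem_subsphere_iff]
      simp [GraphOfGroups.edgeSubgroup]
  refine ⟨main, ?_, hinter, Set.range fun e => BNS.subsphere (Γ.edgeSubgroup T e),
    Set.finite_range _, ?_, ?_⟩
  · ext ξ
    induction ξ using Module.Ray.ind with
    | h φ hφ =>
      rw [Set.mem_neg, neg_rayOfNeZero]
      refine (main φ hφ).trans (Iff.trans ?_ (main (-φ) (neg_ne_zero.2 hφ)).symm)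
      simp
  · have : Group.FG (Γ.FundamentalGroup T) := by
      choose S hS hS' using fun v => Group.fg_iff.1 (hvert v).1
      exact Group.fg_iff.2 ⟨_, GraphOfGroups.closure_iUnion_generators hS,
        (Set.finite_iUnion fun v => (hS' v).image _).union (Set.finite_range _)⟩
    rintro _ ⟨e, rfl⟩
    exact ⟨_, BNS.isRationalSubspace_vanishing (Γ.edgeSubgroup T e), rfl⟩
  · rw [hinter, Set.sUnion_range, Set.compl_iUnion]
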